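/- **Theorem ($(\varepsilon,\delta)$-DP guarantee of objective perturbation).** Let $\Theta\subseteq\mathbb R^d$ be nonempty, closed and convex, let $\mathcal Z$ be a set of possible records, and for every $z\in\mathcal Z$ let $\ell(\cdot\,;z)$ be a real function that is convex and twice differentiable on an open set containing $\Theta$ (one open set for all $z$). Suppose that for all $\theta\in\Theta$ and $z\in\mathcal Z$ we have $\|\nabla\ell(\theta;z)\|_2\le L$, every eigenvalue of $\nabla^2\ell(\theta;z)$ is at most $\eta$, and $\nabla^2\ell(\theta;z)$ has rank at most $R$. For a dataset $Z=(z_1,\dots,z_n)\in\mathcal Z^n$ and $b\in\mathbb R^d$ put $$\hat\theta(Z,b)=\operatorname*{argmin}_{\theta\in\Theta}\ \sum_{i=1}^n\ell(\theta;z_i)+\frac{\Delta}{2}\|\theta\|_2^2+b^\top\theta .$$ Let $\varepsilon,\delta>0$, $q\in(0,1)$ and $\Delta>0$, and suppose that $$\Delta\ \ge\ \frac{R\,\eta}{(1-q)\,\varepsilon}\qquad\text{and}\qquad \sigma\ \ge\ \frac{L\left(\sqrt{d+2\sqrt{d\log(2/\delta)}+2\log(2/\delta)}+\sqrt{d+2\sqrt{d\log(2/\delta)}+2\log(2/\delta)+2q\varepsilon}\right)}{q\,\varepsilon}$$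 (with $\sqrt{x}$ read as $0$ for $x<0$, which occurs only if $\delta>2$). Then the minimizer $\hat\theta(Z,b)$ exists and is unique for all $Z$ and $b$, it is a measurable function of $b$, and the objective perturbation mechanism $Z\mapsto\hat\theta(Z,b)$ with $b\sim N(0,\sigma^2I_d)$ satisfies bounded $(\varepsilon,\delta)$-differential privacy: for all $Z,Z'\in\mathcal Z^n$ that differ in at most one entry and every Borel set $S\subseteq\mathbb R^d$, $$\mathbb P\big(\hat\theta(Z,b)\in S\big)\ \le\ e^{\varepsilon}\,\mathbb P\big(\hat\theta(Z',b)\in S\big)+\delta .$$ -/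

import Mathlib

open MeasureTheory ProbabilityTheory

namespace ObjPert

/-- The perturbed objective `∑ ℓ(θ; Z i) + (Δ / 2) ‖θ‖² + bᵀ θ` of a dataset `Z` of `n` records. -/
noncomputable def objective {d n : ℕ} {𝒵 : Type*} (ℓ : EuclideanSpace ℝ (Fin d) → 𝒵 → ℝ) (Δ : ℝ)
    (Z : Fin n → 𝒵) (b θ : EuclideanSpace ℝ (Fin d)) : ℝ :=
  (∑ i, ℓ θ (Z i)) + Δ / 2 * ‖θ‖ ^ 2 + inner ℝ b θ

/-- `θ` minimizes the perturbed objective over `Θ`. -/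
def IsMinimizer {d n : ℕ} {𝒵 : Type*} (Θ : Set (EuclideanSpace ℝ (Fin d)))
    (ℓ : EuclideanSpace ℝ (Fin d) → 𝒵 → ℝ) (Δ : ℝ)
    (Z : Fin n → 𝒵) (b θ : EuclideanSpace ℝ (Fin d)) : Prop :=
  θ ∈ Θ ∧ IsMinOn (objective ℓ Δ Z b) Θ θ

/-- The estimator `argmin_{θ ∈ Θ}` of the perturbed objective, as a function of the dataset `Z` and
the noise vector `b` (an arbitrary point if there is no minimizer). -/
noncomputable def estimator {d n : ℕ} {𝒵 : Type*} (Θ : Set (EuclideanSpace ℝ (Fin d)))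
    (ℓ : EuclideanSpace ℝ (Fin d) → 𝒵 → ℝ) (Δ : ℝ)
    (Z : Fin n → 𝒵) (b : EuclideanSpace ℝ (Fin d)) : EuclideanSpace ℝ (Fin d) :=
  Classical.epsilon (IsMinimizer Θ ℓ Δ Z b)

/-- The Gaussian law `N(0, σ² I)` on `ℝᵈ`. -/
noncomputable def noise (d : ℕ) (σ : ℝ) : Measure (EuclideanSpace ℝ (Fin d)) :=
  (stdGaussian (EuclideanSpace ℝ (Fin d))).map (fun x => σ • x)

/-- Objective perturbation: a dataset `Z` is sent to the law of the estimator when the noise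
vector has law `N(0, σ² I)`. -/
noncomputable def mechanism {d : ℕ} (n : ℕ) {𝒵 : Type*} (Θ : Set (EuclideanSpace ℝ (Fin d)))
    (ℓ : EuclideanSpace ℝ (Fin d) → 𝒵 → ℝ) (Δ σ : ℝ)
    (Z : Fin n → 𝒵) : Measure (EuclideanSpace ℝ (Fin d)) :=
  (noise d σ).map (estimator Θ ℓ Δ Z)

/-- Two datasets of the same size are `t`-neighboring if they agree outside the `t`-th entry. -/
def Neighboring {n : ℕ} {𝒵 : Type*} (t : Fin n) (Z Z' : Fin n → 𝒵) : Prop :=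
  ∀ i, i ≠ t → Z i = Z' i

/-- Bounded `(ε, δ)`-differential privacy of a randomized algorithm, given by the laws `M Z` of its
outputs. -/
def IsBoundedDP {n : ℕ} {𝒵 Ω : Type*} [MeasurableSpace Ω] (M : (Fin n → 𝒵) → Measure Ω)
    (ε δ : ℝ) : Prop :=
  ∀ (t : Fin n) (Z Z' : Fin n → 𝒵), Neighboring t Z Z' → ∀ S : Set Ω, MeasurableSet S →
    M Z S ≤ ENNReal.ofReal (Real.exp ε) * M Z' S + ENNReal.ofReal δ

/-- The Hessian of `f` at `θ`: the derivative of the gradient. -/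
noncomputable def hessian {d : ℕ} (f : EuclideanSpace ℝ (Fin d) → ℝ)
    (θ : EuclideanSpace ℝ (Fin d)) : EuclideanSpace ℝ (Fin d) →L[ℝ] EuclideanSpace ℝ (Fin d) :=
  fderiv ℝ (gradient f) θ

end ObjPert

/-!
The proof is a pathwise coupling of the noise. If `b` is the noise for `Z`, and `θ̂ = θ̂(Z, b)`, then
the noise `T b = b + ∇ℓ(θ̂; z_t) - ∇ℓ(θ̂; z'_t)` gives the same gradient of the objective for the
neighbouring dataset `Z'`, so by the variational inequality that characterizes minimizers over `Θ`
it gives the same estimator: `θ̂(Z', T b) = θ̂(Z, b)` (`estimator_shift`). In particular `T` is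
injective, and the event `θ̂(Z', ·) ∈ S` contains the image under `T` of the event `θ̂(Z, ·) ∈ S`.
It remains to see how much Gaussian mass `T` can lose.

* Density. `T` moves `b` by at most `2 L`, so when `‖b‖ ≤ σ √(d + 2 √(d log (2/δ)) + 2 log (2/δ))`
  the choice of `σ` makes the density drop by at most a factor `exp (q ε)` (`noiseDensity_le`,
  `noise_scale_bound`). The other `b` have probability at most `δ / 2`, by the chi-squared tail
  bound `noise_norm_gt_le`.

* Volume. The solution map `b ↦ θ̂(Z, b)` is `1/Δ`-Lipschitz because the objective is strongly
  convex, so it is differentiable almost everywhere by Rademacher's theorem; the exceptional null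
  set can be discarded, since only the image of its complement has to be measured. With
  `K = -D θ̂`, the derivative of `T` is `1 - h K + h' K`, where `h`, `h'` are the Hessians of the two
  losses at `θ̂`. Differentiating the strong monotonicity of the solution map gives
  `⟪v, K v⟫ ≥ Δ ‖K v‖² + ⟪h K v, K v⟫` (`fderiv_estimator_bound`). This holds for the constrained
  problem too, so that no smoothness of `Θ` and no regularization of the constraint is needed.
  It yields `det (1 - h K + h' K) ≥ exp (-R η / Δ) ≥ exp (-(1 - q) ε)` (`exp_neg_le_det`):
  each of the at most `R` eigendirections of `h`, subtracted one at a time, multiplies the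
  determinant by at least `Δ / (Δ + η)`, and adding `h'` does not decrease it.

The two factors multiply to `exp ε` in the change of variables `noise_le_exp_mul_noise_image`.
-/

namespace ObjPert

/-! ### A determinant inequality -/

section Determinant

variable {E : Type*} [NormedAddCommGroup E] [InnerProductSpace ℝ E]

/-- The operator `x ↦ a ⟪e, K x⟫ e`: a rank-one self-adjoint operator composed with `K`. -/
noncomputable def rankOneComp (K : E →ₗ[ℝ] E) (a : ℝ) (e : E) : E →ₗ[ℝ] E :=
  (a • ((innerₛₗ ℝ e) ∘ₗ K)).smulRight e

lemma rankOneComp_apply (K : E →ₗ[ℝ] E) (a : ℝ) (e x : E) :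
    rankOneComp K a e x = (a * inner ℝ e (K x)) • e := by
  simp [rankOneComp]

variable [FiniteDimensional ℝ E]

/-- The matrix determinant lemma. -/
lemma det_add_smulRight_apply (N : E →ₗ[ℝ] E) (f : E →ₗ[ℝ] ℝ) (w : E) :
    LinearMap.det (N + f.smulRight (N w)) = LinearMap.det N * (1 + f w) := by
  have h : N + f.smulRight (N w) = N ∘ₗ LinearMap.transvection f w := by
    ext x
    simp [LinearMap.transvection.apply]
  rw [h, LinearMap.det_comp, LinearMap.transvection.det]

lemma exists_apply_eq_of_det_pos {N : E →ₗ[ℝ] E} (hN : 0 < LinearMap.det N) (v : E) :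
    ∃ w, N w = v := by
  have h : IsUnit N := (LinearMap.isUnit_iff_isUnit_det N).2 hN.ne'.isUnit
  exact ((Module.End.isUnit_iff N).1 h).2 v

lemma det_add_rankOneComp {N K : E →ₗ[ℝ] E} {a : ℝ} {e w : E} (hw : N w = e) :
    LinearMap.det (N + rankOneComp K a e) = LinearMap.det N * (1 + a * inner ℝ e (K w)) := by
  subst hw
  rw [rankOneComp, det_add_smulRight_apply]
  simp

/-- Adding a positive rank-one term in front of `K` does not decrease the determinant, as long as
`K ∘ N⁻¹` is monotone. -/
lemma le_det_add_rankOneComp {N K : E →ₗ[ℝ] E} {a : ℝ} {e : E} (hN : 0 < LinearMap.det N)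
    (ha : 0 ≤ a) (h : ∀ w, 0 ≤ inner ℝ (N w) (K w)) :
    LinearMap.det N ≤ LinearMap.det (N + rankOneComp K a e) := by
  obtain ⟨w, hw⟩ := exists_apply_eq_of_det_pos hN e
  have hx := h w
  rw [hw] at hx
  rw [det_add_rankOneComp hw]
  nlinarith [mul_nonneg hN.le (mul_nonneg ha hx)]

/-- The cost of subtracting one rank-one term. With `N w = e`, the determinant is multiplied by
`1 - a x` for `x = ⟪e, K w⟫`, and the hypothesis at `w` reads `(Δ + a) x² ≤ x`. -/
lemma le_det_sub_rankOneComp {N K : E →ₗ[ℝ] E} {Δ a : ℝ} {e : E} (hN : 0 < LinearMap.det N)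
    (hΔ : 0 < Δ) (ha : 0 ≤ a) (he : ‖e‖ = 1)
    (h : ∀ w, Δ * ‖K w‖ ^ 2 + a * inner ℝ e (K w) ^ 2 ≤ inner ℝ (N w) (K w)) :
    LinearMap.det N * (Δ / (Δ + a)) ≤ LinearMap.det (N + rankOneComp K (-a) e) := by
  obtain ⟨w, hw⟩ := exists_apply_eq_of_det_pos hN e
  have hx := h w
  rw [hw] at hx
  rw [det_add_rankOneComp hw]
  set x : ℝ := inner ℝ e (K w)
  refine mul_le_mul_of_nonneg_left ?_ hN.le
  have hcs : x ^ 2 ≤ ‖K w‖ ^ 2 := by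
    have := abs_real_inner_le_norm e (K w)
    rw [he, one_mul] at this
    exact sq_le_sq.2 (by rwa [abs_of_nonneg (norm_nonneg (K w))])
  have hquad : (Δ + a) * x ^ 2 ≤ x := by nlinarith
  have hx1 : (Δ + a) * x ≤ 1 := by
    by_contra! hlt
    have hpos : 0 < x := by
      by_contra! hx0
      nlinarith [mul_nonpos_of_nonneg_of_nonpos (by positivity : 0 ≤ Δ + a) hx0]
    nlinarith
  rw [div_le_iff₀ (by positivity)]
  nlinarith

lemma le_det_add_sum_rankOneComp {ι : Type*} (s : Finset ι) {K : E →ₗ[ℝ] E} {a : ι → ℝ}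
    {e : ι → E} (ha : ∀ i, 0 ≤ a i) {N : E →ₗ[ℝ] E} (hN : 0 < LinearMap.det N)
    (h : ∀ w, 0 ≤ inner ℝ (N w) (K w)) :
    LinearMap.det N ≤ LinearMap.det (N + ∑ i ∈ s, rankOneComp K (a i) (e i)) := by
  classical
  induction s using Finset.induction_on generalizing N with
  | empty => simp
  | insert i s hi ih =>
    have h1 := le_det_add_rankOneComp (e := e i) hN (ha i) h
    rw [Finset.sum_insert hi, ← add_assoc]
    refine h1.trans (ih (hN.trans_le h1) fun w => ?_)
    rw [LinearMap.add_apply, inner_add_left, rankOneComp_apply, real_inner_smul_left, mul_assoc]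
    exact add_nonneg (h w) (mul_nonneg (ha i) (mul_self_nonneg _))

lemma le_det_sub_sum_rankOneComp {ι : Type*} (s : Finset ι) {K : E →ₗ[ℝ] E} {Δ : ℝ} {a : ι → ℝ}
    {e : ι → E} (hΔ : 0 < Δ) (ha : ∀ i, 0 ≤ a i) (he : ∀ i, ‖e i‖ = 1) {N : E →ₗ[ℝ] E}
    (hN : 0 < LinearMap.det N)
    (h : ∀ w, Δ * ‖K w‖ ^ 2 + ∑ i ∈ s, a i * inner ℝ (e i) (K w) ^ 2 ≤ inner ℝ (N w) (K w)) :
    LinearMap.det N * ∏ i ∈ s, (Δ / (Δ + a i)) ≤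
      LinearMap.det (N + ∑ i ∈ s, rankOneComp K (-a i) (e i)) := by
  classical
  induction s using Finset.induction_on generalizing N with
  | empty => simp
  | insert i s hi ih =>
    simp only [Finset.sum_insert hi, Finset.prod_insert hi] at h ⊢
    have hs : ∀ w, 0 ≤ ∑ j ∈ s, a j * inner ℝ (e j) (K w) ^ 2 := fun w =>
      Finset.sum_nonneg fun j _ => mul_nonneg (ha j) (sq_nonneg _)
    have h1 := le_det_sub_rankOneComp hN hΔ (ha i) (he i) fun w => by linarith [h w, hs w]
    have hfrac : 0 < Δ / (Δ + a i) := div_pos hΔ (add_pos_of_pos_of_nonneg hΔ (ha i))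
    rw [← add_assoc, ← mul_assoc]
    refine le_trans (mul_le_mul_of_nonneg_right h1 (Finset.prod_nonneg fun j _ =>
      div_nonneg hΔ.le (add_nonneg hΔ.le (ha j)))) (ih ((mul_pos hN hfrac).trans_le h1) fun w => ?_)
    rw [LinearMap.add_apply, inner_add_left, rankOneComp_apply, real_inner_smul_left]
    nlinarith [h w]

/-- For a symmetric `h`, the operator `h ∘ K` is a sum of rank-one operators composed with `K`. -/
lemma comp_eq_sum_rankOneComp {n : ℕ} (hn : Module.finrank ℝ E = n) {h : E →ₗ[ℝ] E}
    (hs : h.IsSymmetric) (K : E →ₗ[ℝ] E) :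
    h ∘ₗ K = ∑ i, rankOneComp K (hs.eigenvalues hn i) (hs.eigenvectorBasis hn i) := by
  ext x
  rw [LinearMap.sum_apply, LinearMap.comp_apply,
    ← (hs.eigenvectorBasis hn).sum_repr (h (K x))]
  refine Finset.sum_congr rfl fun i _ => ?_
  rw [rankOneComp_apply, hs.eigenvectorBasis_apply_self_apply hn, OrthonormalBasis.repr_apply_apply]
  simp

lemma inner_self_eq_sum_eigenvalues {n : ℕ} (hn : Module.finrank ℝ E = n) {h : E →ₗ[ℝ] E}
    (hs : h.IsSymmetric) (x : E) :
    inner ℝ (h x) x = ∑ i, hs.eigenvalues hn i * inner ℝ (hs.eigenvectorBasis hn i) x ^ 2 := by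
  rw [← (hs.eigenvectorBasis hn).sum_inner_mul_inner (h x) x]
  refine Finset.sum_congr rfl fun i _ => ?_
  rw [real_inner_comm, ← OrthonormalBasis.repr_apply_apply, hs.eigenvectorBasis_apply_self_apply hn,
    OrthonormalBasis.repr_apply_apply]
  simp [pow_two, mul_assoc]

lemma eigenvalues_nonneg_of_inner_nonneg {n : ℕ} (hn : Module.finrank ℝ E = n) {h : E →ₗ[ℝ] E}
    (hs : h.IsSymmetric) (hpos : ∀ x, 0 ≤ inner ℝ (h x) x) (i : Fin n) :
    0 ≤ hs.eigenvalues hn i := by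
  have := hpos (hs.eigenvectorBasis hn i)
  rw [hs.apply_eigenvectorBasis hn i, real_inner_smul_left, real_inner_self_eq_norm_sq] at this
  simpa using this

/-- The sum of the eigenvalues is at most the rank times a bound for the eigenvalues. It is stated
with a nonnegative `c ≥ R η`, because `η < 0` is possible on the zero space. -/
lemma sum_eigenvalues_le {n R : ℕ} (hn : Module.finrank ℝ E = n) {h : E →ₗ[ℝ] E}
    (hs : h.IsSymmetric) {η c : ℝ}
    (hη : ∀ μ : ℝ, Module.End.HasEigenvalue h μ → μ ≤ η)
    (hR : Module.finrank ℝ h.range ≤ R) (hc : 0 ≤ c) (hRc : R * η ≤ c)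
    (hpos : ∀ x, 0 ≤ inner ℝ (h x) x) :
    ∑ i, hs.eigenvalues hn i ≤ c := by
  classical
  set s : Finset (Fin n) := Finset.univ.filter fun i => hs.eigenvalues hn i ≠ 0
  have hcard : s.card ≤ R := by
    have hli : LinearIndependent ℝ
        (fun i : s => (⟨hs.eigenvectorBasis hn i, by
          refine ⟨(hs.eigenvalues hn i)⁻¹ • hs.eigenvectorBasis hn i, ?_⟩
          rw [map_smul, hs.apply_eigenvectorBasis hn i]
          simp [smul_smul, inv_mul_cancel₀ (Finset.mem_filter.1 i.2).2]⟩ : h.range)) := by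
      refine LinearIndependent.of_comp h.range.subtype ?_
      exact (hs.eigenvectorBasis hn).orthonormal.linearIndependent.comp _ Subtype.val_injective
    have := hli.fintype_card_le_finrank
    rw [Fintype.card_coe] at this
    exact this.trans hR
  have hsum : ∑ i, hs.eigenvalues hn i = ∑ i ∈ s, hs.eigenvalues hn i :=
    (Finset.sum_filter_ne_zero _).symm
  have hle : ∀ i, hs.eigenvalues hn i ≤ η := fun i => hη _ (hs.hasEigenvalue_eigenvalues hn i)
  have hbound : ∑ i ∈ s, hs.eigenvalues hn i ≤ s.card * η := by
    simpa using Finset.sum_le_card_nsmul s _ η fun i _ => hle i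
  rw [hsum]
  rcases s.eq_empty_or_nonempty with h0 | ⟨i, hi⟩
  · simpa [h0] using hc
  · have hη0 : 0 ≤ η := (eigenvalues_nonneg_of_inner_nonneg hn hs hpos i).trans (hle i)
    have : (s.card : ℝ) ≤ R := by exact_mod_cast hcard
    nlinarith

/-- The hypothesis on `K` says, for invertible `K`, that the symmetric part of `K⁻¹` is at least
`Δ + h`. Then passing from `1` to `1 - h K + h' K` with a positive `h'` costs at most a factor
`exp (-c / Δ)` in the determinant, where `c` bounds the trace of `h`. The eigendirections of `h` are
subtracted one at a time, each costing a factor `Δ / (Δ + λ)`; adding those of `h'` only increases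
the determinant. No symmetry of `K` is needed. -/
lemma exp_neg_le_det {R : ℕ} {h h' K : E →ₗ[ℝ] E} {Δ η c : ℝ} (hΔ : 0 < Δ)
    (hs : h.IsSymmetric) (hs' : h'.IsSymmetric) (hpos : ∀ x, 0 ≤ inner ℝ (h x) x)
    (hpos' : ∀ x, 0 ≤ inner ℝ (h' x) x)
    (hη : ∀ μ : ℝ, Module.End.HasEigenvalue h μ → μ ≤ η)
    (hR : Module.finrank ℝ h.range ≤ R) (hc : 0 ≤ c) (hRc : R * η ≤ c)
    (hK : ∀ w, Δ * ‖K w‖ ^ 2 + inner ℝ (h (K w)) (K w) ≤ inner ℝ w (K w)) :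
    Real.exp (-(c / Δ)) ≤ LinearMap.det (LinearMap.id - h ∘ₗ K + h' ∘ₗ K) := by
  have ha := eigenvalues_nonneg_of_inner_nonneg rfl hs hpos
  have ha' := eigenvalues_nonneg_of_inner_nonneg rfl hs' hpos'
  have hsub := le_det_sub_sum_rankOneComp Finset.univ (K := K) (N := LinearMap.id)
    (a := hs.eigenvalues rfl) (e := hs.eigenvectorBasis rfl) hΔ ha
    (fun i => OrthonormalBasis.norm_eq_one _ i) (by simp) fun w => by
      rw [← inner_self_eq_sum_eigenvalues rfl hs]; exact hK w
  have hN : LinearMap.id + ∑ i, rankOneComp K (-hs.eigenvalues rfl i) (hs.eigenvectorBasis rfl i)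
      = LinearMap.id - h ∘ₗ K := by
    rw [comp_eq_sum_rankOneComp rfl hs K, sub_eq_add_neg, ← Finset.sum_neg_distrib]
    congr 1
    refine Finset.sum_congr rfl fun i _ => ?_
    ext x
    simp [rankOneComp_apply]
  rw [hN, LinearMap.det_id, one_mul] at hsub
  have hprod : Real.exp (-(c / Δ)) ≤ ∏ i, (Δ / (Δ + hs.eigenvalues rfl i)) := by
    calc Real.exp (-(c / Δ)) ≤ Real.exp (∑ i, -(hs.eigenvalues rfl i / Δ)) := by
          rw [Finset.sum_neg_distrib, ← Finset.sum_div]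
          gcongr
          exact sum_eigenvalues_le rfl hs hη hR hc hRc hpos
      _ = ∏ i, Real.exp (-(hs.eigenvalues rfl i / Δ)) := Real.exp_sum _ _
      _ ≤ _ := by
          refine Finset.prod_le_prod (fun i _ => (Real.exp_pos _).le) fun i _ => ?_
          have h1 := Real.add_one_le_exp (hs.eigenvalues rfl i / Δ)
          have h2 : 0 < Δ + hs.eigenvalues rfl i := add_pos_of_pos_of_nonneg hΔ (ha i)
          rw [Real.exp_neg, inv_le_comm₀ (Real.exp_pos _) (by positivity), inv_div, add_div,
            div_self hΔ.ne']
          linarith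
  have hadd := le_det_add_sum_rankOneComp Finset.univ (K := K) (N := LinearMap.id - h ∘ₗ K)
    (a := hs'.eigenvalues rfl) (e := hs'.eigenvectorBasis rfl) ha'
    ((Real.exp_pos _).trans_le (hprod.trans hsub)) fun w => by
      rw [LinearMap.sub_apply, inner_sub_left, LinearMap.id_apply, LinearMap.comp_apply]
      nlinarith [hK w, mul_nonneg hΔ.le (sq_nonneg ‖K w‖)]
  rw [← comp_eq_sum_rankOneComp rfl hs' K] at hadd
  exact hprod.trans (hsub.trans hadd)

end Determinant

/-! ### Density and norm of the Gaussian noise -/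

section Gaussian

variable {d : ℕ}

/-- The Lebesgue density of `N(0, σ² I)`. -/
noncomputable def noiseDensity (d : ℕ) (σ : ℝ) (x : EuclideanSpace ℝ (Fin d)) : ℝ :=
  (2 * Real.pi * σ ^ 2) ^ (-(d / 2 : ℝ)) * Real.exp (-(1 / (2 * σ ^ 2)) * ‖x‖ ^ 2)

lemma noiseDensity_nonneg (σ : ℝ) (x : EuclideanSpace ℝ (Fin d)) : 0 ≤ noiseDensity d σ x := by
  unfold noiseDensity; positivity

lemma continuous_noiseDensity (σ : ℝ) : Continuous (noiseDensity d σ) := by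
  unfold noiseDensity; fun_prop

instance (σ : ℝ) : IsProbabilityMeasure (noise d σ) :=
  Measure.isProbabilityMeasure_map (by fun_prop)

lemma integrable_exp_neg_mul_sq_norm {b : ℝ} (hb : 0 < b) :
    Integrable fun x : EuclideanSpace ℝ (Fin d) => Real.exp (-b * ‖x‖ ^ 2) := by
  have h := (GaussianFourier.integrable_cexp_neg_mul_sq_norm_add (b := (b : ℂ)) (by simpa using hb)
    0 (0 : EuclideanSpace ℝ (Fin d))).norm
  refine h.congr (Filter.Eventually.of_forall fun x => ?_)
  simp only [Complex.norm_exp]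
  norm_cast
  simp

lemma noise_eq_withDensity {σ : ℝ} (hσ : 0 < σ) :
    noise d σ = volume.withDensity fun x => ENNReal.ofReal (noiseDensity d σ x) := by
  have hb : 0 < 1 / (2 * σ ^ 2) := by positivity
  have hfin : IsFiniteMeasure (volume.withDensity fun x : EuclideanSpace ℝ (Fin d) =>
      ENNReal.ofReal (noiseDensity d σ x)) :=
    isFiniteMeasure_withDensity_ofReal ((integrable_exp_neg_mul_sq_norm hb).const_mul _).2
  refine Measure.ext_of_charFun (funext fun t => ?_)
  rw [noise, charFun_map_smul, charFun_stdGaussian, charFun_apply,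
    integral_withDensity_eq_integral_toReal_smul
      (continuous_noiseDensity σ).measurable.ennreal_ofReal (by simp)]
  have key := GaussianFourier.integral_cexp_neg_mul_sq_norm_add
    (b := ((1 / (2 * σ ^ 2) : ℝ) : ℂ)) (by rwa [Complex.ofReal_re]) Complex.I t
  have h1 : ∀ x : EuclideanSpace ℝ (Fin d),
      (ENNReal.ofReal (noiseDensity d σ x)).toReal • Complex.exp ((inner ℝ x t : ℝ) * Complex.I)
      = (((2 * Real.pi * σ ^ 2) ^ (-(d / 2 : ℝ)) : ℝ) : ℂ) *
        Complex.exp (-((1 / (2 * σ ^ 2) : ℝ) : ℂ) * ‖x‖ ^ 2 + Complex.I * (inner ℝ t x : ℝ)) := by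
    intro x
    rw [ENNReal.toReal_ofReal (noiseDensity_nonneg σ x), noiseDensity, Complex.real_smul,
      Complex.exp_add, Complex.ofReal_mul, Complex.ofReal_exp, real_inner_comm t x,
      mul_comm Complex.I]
    push_cast
    ring
  simp_rw [h1]
  rw [integral_const_mul, key]
  have h2 : (Real.pi : ℂ) / ((1 / (2 * σ ^ 2) : ℝ) : ℂ) = ((2 * Real.pi * σ ^ 2 : ℝ) : ℂ) := by
    have : (σ : ℂ) ≠ 0 := by exact_mod_cast hσ.ne'
    push_cast; field_simp
  have hc : 0 < 2 * Real.pi * σ ^ 2 := by positivity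
  have h3 : (((2 * Real.pi * σ ^ 2 : ℝ) : ℂ)) ^
      (Module.finrank ℝ (EuclideanSpace ℝ (Fin d)) / 2 : ℂ)
      = (((2 * Real.pi * σ ^ 2) ^ (d / 2 : ℝ) : ℝ) : ℂ) := by
    rw [Complex.ofReal_cpow hc.le]
    simp
  rw [h2, h3, ← mul_assoc, ← Complex.ofReal_mul, ← Real.rpow_add hc]
  simp only [neg_add_cancel, Real.rpow_zero, Complex.ofReal_one, one_mul, Complex.I_sq]
  congr 1
  rw [norm_smul, Real.norm_eq_abs]
  have : (σ : ℂ) ≠ 0 := by exact_mod_cast hσ.ne'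
  push_cast
  rw [mul_pow, ← Complex.ofReal_pow |σ|, sq_abs]
  push_cast
  field_simp
  norm_num

/-- The moment generating function of `‖b‖² / σ²`, which has the chi-squared law. -/
lemma lintegral_exp_mul_sq_norm_noise {σ s : ℝ} (hσ : 0 < σ) (hs : s < 1 / 2) :
    ∫⁻ x, ENNReal.ofReal (Real.exp (s * (‖x‖ ^ 2 / σ ^ 2))) ∂(noise d σ)
      = ENNReal.ofReal ((1 - 2 * s) ^ (-(d / 2 : ℝ))) := by
  have hs' : 0 < 1 - 2 * s := by linarith
  have hb : 0 < (1 - 2 * s) / (2 * σ ^ 2) := by positivity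
  have hc : 0 < 2 * Real.pi * σ ^ 2 := by positivity
  rw [noise_eq_withDensity hσ, lintegral_withDensity_eq_lintegral_mul _
    (continuous_noiseDensity σ).measurable.ennreal_ofReal (by fun_prop)]
  have h1 : ∀ x : EuclideanSpace ℝ (Fin d),
      ((fun x : EuclideanSpace ℝ (Fin d) => ENNReal.ofReal (noiseDensity d σ x)) *
        fun x : EuclideanSpace ℝ (Fin d) => ENNReal.ofReal (Real.exp (s * (‖x‖ ^ 2 / σ ^ 2)))) x
      = ENNReal.ofReal ((2 * Real.pi * σ ^ 2) ^ (-(d / 2 : ℝ)) *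
          Real.exp (-((1 - 2 * s) / (2 * σ ^ 2)) * ‖x‖ ^ 2)) := by
    intro x
    rw [Pi.mul_apply, ← ENNReal.ofReal_mul (noiseDensity_nonneg σ x), noiseDensity, mul_assoc,
      ← Real.exp_add]
    congr 3
    field_simp
    ring
  simp_rw [h1]
  rw [← ofReal_integral_eq_lintegral_ofReal
    ((integrable_exp_neg_mul_sq_norm hb).const_mul _)
    (Filter.Eventually.of_forall fun x => by positivity), integral_const_mul,
    GaussianFourier.integral_rexp_neg_mul_sq_norm hb]
  have h2 : Real.pi / ((1 - 2 * s) / (2 * σ ^ 2)) = (2 * Real.pi * σ ^ 2) * (1 - 2 * s)⁻¹ := by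
    field_simp
  rw [h2, Real.mul_rpow hc.le (by positivity), ← mul_assoc, finrank_euclideanSpace_fin,
    ← Real.rpow_add hc, Real.inv_rpow hs'.le, ← Real.rpow_neg hs'.le]
  simp

/-- The exponent in Chernoff's bound at `s = x / (c + 2 x)`, where `c = √d` and `exp (-x²)` is
the tail probability:
this `s` is the minimizer once `-log (1 - 2 s)` is replaced by its upper bound
`2 s + 2 s² / (1 - 2 s)`. -/
lemma one_sub_rpow_mul_exp_le {c x : ℝ} (hc : 0 < c) (hx : 0 ≤ x) :
    (1 - 2 * (x / (c + 2 * x))) ^ (-(c ^ 2 / 2)) *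
      Real.exp (-(x / (c + 2 * x)) * (c ^ 2 + 2 * (c * x) + 2 * x ^ 2)) ≤ Real.exp (-x ^ 2) := by
  have hcx : 0 < c + 2 * x := by positivity
  have h1 : 1 - 2 * (x / (c + 2 * x)) = (1 + 2 * x / c)⁻¹ := by field_simp; ring
  have hr : 0 ≤ 2 * x / c := by positivity
  -- `log (1 + r) ≤ r (2 + r) / (2 (1 + r))`, which is `log y ≤ sinh (log y)` at `y = 1 + r`
  have hlog : Real.log (1 + 2 * x / c) ≤ (2 * x / c) * (2 + 2 * x / c) / (2 * (1 + 2 * x / c)) := by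
    have h := Real.self_le_sinh_iff.2 (Real.log_nonneg (le_add_of_nonneg_right hr))
    rw [Real.sinh_log (by positivity)] at h
    refine h.trans (le_of_eq ?_)
    field_simp
    ring
  rw [h1, Real.inv_rpow (by positivity), ← Real.rpow_neg (by positivity), neg_neg,
    Real.rpow_def_of_pos (by positivity), ← Real.exp_add]
  gcongr
  have h2 : Real.log (1 + 2 * x / c) * (c ^ 2 / 2) ≤
      (2 * x / c) * (2 + 2 * x / c) / (2 * (1 + 2 * x / c)) * (c ^ 2 / 2) := by gcongr
  refine (add_le_add_left h2 _).trans (le_of_eq ?_)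
  field_simp
  ring

/-- The Laurent–Massart bound for the upper tail of the chi-squared law. -/
lemma noise_norm_gt_le {σ x : ℝ} (hσ : 0 < σ) (hx : 0 ≤ x) :
    noise d σ {b | σ * √(d + 2 * √(d * x) + 2 * x) < ‖b‖} ≤ ENNReal.ofReal (Real.exp (-x)) := by
  rcases Nat.eq_zero_or_pos d with rfl | hd
  · have : {b : EuclideanSpace ℝ (Fin 0) |
        σ * √((0 : ℕ) + 2 * √((0 : ℕ) * x) + 2 * x) < ‖b‖} = ∅ := by
      ext b
      simp only [Set.mem_ofPred_eq, Set.mem_empty_iff_false, iff_false, not_lt]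
      rw [Subsingleton.elim b 0, norm_zero]
      positivity
    rw [this]; simp
  have hd' : (0 : ℝ) < d := by exact_mod_cast hd
  set c := √(d : ℝ)
  set y := √x
  have hc : 0 < c := Real.sqrt_pos.2 hd'
  have hy : 0 ≤ y := Real.sqrt_nonneg _
  have hc2 : c ^ 2 = d := Real.sq_sqrt hd'.le
  have hy2 : y ^ 2 = x := Real.sq_sqrt hx
  have hcy : √(d * x) = c * y := Real.sqrt_mul hd'.le x
  set s := y / (c + 2 * y)
  have hcy' : 0 < c + 2 * y := by positivity
  have hs0 : 0 ≤ s := by positivity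
  have hs : s < 1 / 2 := by
    rw [div_lt_iff₀ hcy']; linarith
  set a := (d : ℝ) + 2 * √(d * x) + 2 * x
  have ha : 0 ≤ a := by positivity
  have hsub : {b : EuclideanSpace ℝ (Fin d) | σ * √a < ‖b‖} ⊆
      {b | ENNReal.ofReal (Real.exp (s * a)) ≤
        ENNReal.ofReal (Real.exp (s * (‖b‖ ^ 2 / σ ^ 2)))} := by
    intro b hb
    have h1 : (σ * √a) ^ 2 ≤ ‖b‖ ^ 2 := pow_le_pow_left₀ (by positivity) (le_of_lt hb) 2
    rw [mul_pow, Real.sq_sqrt ha] at h1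
    refine ENNReal.ofReal_le_ofReal (Real.exp_le_exp.2 (mul_le_mul_of_nonneg_left ?_ hs0))
    rw [le_div_iff₀ (by positivity)]
    linarith
  refine (measure_mono hsub).trans ?_
  refine (meas_ge_le_lintegral_div (by fun_prop) (by simp [Real.exp_pos])
    ENNReal.ofReal_ne_top).trans ?_
  rw [lintegral_exp_mul_sq_norm_noise hσ hs, ← ENNReal.ofReal_div_of_pos (Real.exp_pos _)]
  refine ENNReal.ofReal_le_ofReal ?_
  have key := one_sub_rpow_mul_exp_le hc hy
  rw [hc2, hy2, ← hcy] at key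
  rw [div_eq_mul_inv, ← Real.exp_neg, ← neg_mul]
  exact key

/-- The ratio of the densities at two points is controlled by the norms of the first point and of
the displacement. -/
lemma noiseDensity_le {σ r t κ : ℝ} (hσ : 0 < σ) {x v : EuclideanSpace ℝ (Fin d)}
    (hx : ‖x‖ ≤ r) (hv : ‖v‖ ≤ t) (hrt : 2 * r * t + t ^ 2 ≤ 2 * σ ^ 2 * κ) :
    noiseDensity d σ x ≤ Real.exp κ * noiseDensity d σ (x + v) := by
  unfold noiseDensity
  rw [mul_left_comm, ← Real.exp_add]
  gcongr
  have h1 : ‖x + v‖ ^ 2 ≤ ‖x‖ ^ 2 + 2 * σ ^ 2 * κ := by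
    have h2 := norm_add_le x v
    nlinarith [norm_nonneg x, norm_nonneg v, norm_nonneg (x + v)]
  have h3 : 1 / (2 * σ ^ 2) * ‖x + v‖ ^ 2 ≤ 1 / (2 * σ ^ 2) * (‖x‖ ^ 2 + 2 * σ ^ 2 * κ) := by gcongr
  have h4 : 1 / (2 * σ ^ 2) * (‖x‖ ^ 2 + 2 * σ ^ 2 * κ) = 1 / (2 * σ ^ 2) * ‖x‖ ^ 2 + κ := by
    field_simp
  linarith

end Gaussian

/-! ### Gradients and Hessians of convex functions -/

section Convex

open Filter Topology

variable {d : ℕ} {U : Set (EuclideanSpace ℝ (Fin d))} {f : EuclideanSpace ℝ (Fin d) → ℝ}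

lemma hasDerivAt_line (x v : EuclideanSpace ℝ (Fin d)) :
    HasDerivAt (fun s : ℝ => x + s • v) v 0 := by
  simpa using ((hasDerivAt_id (0 : ℝ)).smul_const v).const_add x

/-- Along a segment, a differentiable function has the derivative prescribed by its gradient. -/
lemma hasDerivAt_comp_segment {g x v : EuclideanSpace ℝ (Fin d)} (hg : HasGradientAt f g x) :
    HasDerivAt (fun s : ℝ => f (x + s • v)) (inner ℝ g v) 0 := by
  have hg' := hg.hasFDerivAt
  rw [show x = x + (0 : ℝ) • v by simp] at hg'
  simpa [Function.comp_def] using hg'.comp_hasDerivAt (0 : ℝ) (hasDerivAt_line x v)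

/-- The first-order lower bound of a convex function. -/
lemma add_inner_gradient_le (hf : ConvexOn ℝ U f) {x y g : EuclideanSpace ℝ (Fin d)}
    (hx : x ∈ U) (hy : y ∈ U) (hg : HasGradientAt f g x) :
    f x + inner ℝ g (y - x) ≤ f y := by
  have hφ : ConvexOn ℝ (Set.Icc (0 : ℝ) 1) fun s : ℝ => f (x + s • (y - x)) := by
    have h := hf.comp_affineMap (AffineMap.lineMap x y)
    have heq : (f ∘ (AffineMap.lineMap x y : ℝ →ᵃ[ℝ] _)) = fun s : ℝ => f (x + s • (y - x)) := by
      ext s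
      simp [AffineMap.lineMap_apply_module', add_comm]
    rw [heq] at h
    refine h.subset (fun s hs => ?_) (convex_Icc 0 1)
    exact hf.1.segment_subset hx hy (segment_eq_image_lineMap ℝ x y ▸ Set.mem_image_of_mem _ hs)
  have h := hφ.le_slope_of_hasDerivAt (by simp) (by simp) zero_lt_one (hasDerivAt_comp_segment hg)
  simp [slope_def_field] at h
  linarith

/-- The gradient of a convex function is monotone. -/
lemma inner_gradient_sub_nonneg (hf : ConvexOn ℝ U f) {x y g g' : EuclideanSpace ℝ (Fin d)}
    (hx : x ∈ U) (hy : y ∈ U) (hg : HasGradientAt f g x) (hg' : HasGradientAt f g' y) :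
    0 ≤ inner ℝ (g - g') (x - y) := by
  have h1 := add_inner_gradient_le hf hx hy hg
  have h2 := add_inner_gradient_le hf hy hx hg'
  rw [← neg_sub x y, inner_neg_right] at h1
  rw [inner_sub_left]
  linarith

/-- The Hessian of a twice differentiable function is symmetric, without continuity of the second
derivative. -/
lemma hessian_isSymmetric {x : EuclideanSpace ℝ (Fin d)} (hU : U ∈ 𝓝 x)
    (hf : DifferentiableOn ℝ f U) (hf2 : DifferentiableAt ℝ (gradient f) x) :
    (hessian f x).toLinearMap.IsSymmetric := by
  intro v w
  have h1 : ∀ᶠ y in 𝓝 x, HasFDerivAt f (innerSL ℝ (gradient f y)) y := by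
    filter_upwards [eventually_mem_nhds_iff.2 hU] with y hy
    exact (hf.hasGradientAt hy).hasFDerivAt
  have h2 : HasFDerivAt (fun y => innerSL ℝ (gradient f y))
      ((innerSL ℝ).toContinuousLinearMap.comp (hessian f x)) x :=
    (innerSL ℝ).toContinuousLinearMap.hasFDerivAt.comp x hf2.hasFDerivAt
  have h3 := second_derivative_symmetric_of_eventually_of_real h1 h2 v w
  simp only [ContinuousLinearMap.comp_apply] at h3
  change inner ℝ (hessian f x v) w = inner ℝ v (hessian f x w)
  rw [real_inner_comm _ v]
  exact h3

/-- Dividing an inequality between quadratic quantities along a curve by the square of the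
parameter: the curves `p`, `q`, `g` enter only through their derivatives at `0`. -/
lemma quadratic_limit_nonpos {E : Type*} [NormedAddCommGroup E] [InnerProductSpace ℝ E]
    {p g : ℝ → E} {p' g' v : E} {Δ : ℝ} (hp : HasDerivAt p p' 0) (hg : HasDerivAt g g' 0)
    (h : ∀ᶠ s in 𝓝[>] (0 : ℝ), Δ * ‖p s - p 0‖ ^ 2 + inner ℝ (g s - g 0) (p s - p 0)
      + inner ℝ (s • v) (p s - p 0) ≤ 0) :
    Δ * ‖p'‖ ^ 2 + inner ℝ g' p' + inner ℝ v p' ≤ 0 := by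
  have hp1 := (hasDerivAt_iff_tendsto_slope.1 hp).mono_left
    (nhdsWithin_mono _ (show Set.Ioi (0 : ℝ) ⊆ {0}ᶜ from fun s hs => ne_of_gt hs))
  have hg1 := (hasDerivAt_iff_tendsto_slope.1 hg).mono_left
    (nhdsWithin_mono _ (show Set.Ioi (0 : ℝ) ⊆ {0}ᶜ from fun s hs => ne_of_gt hs))
  refine le_of_tendsto ((((hp1.norm.pow 2).const_mul Δ).add (hg1.inner hp1)).add
    (tendsto_const_nhds.inner hp1)) ?_
  filter_upwards [h, self_mem_nhdsWithin] with s hs hs0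
  have hs0 : 0 < s := hs0
  have h1 : p s - p 0 = s • slope p 0 s := by simp [slope_def_module, smul_smul, hs0.ne']
  have h2 : g s - g 0 = s • slope g 0 s := by simp [slope_def_module, smul_smul, hs0.ne']
  rw [h1, h2, norm_smul, real_inner_smul_left, real_inner_smul_left, real_inner_smul_right,
    real_inner_smul_right, Real.norm_of_nonneg hs0.le] at hs
  by_contra! hlt
  nlinarith [mul_pos (mul_pos hs0 hs0) hlt]

lemma inner_hessian_nonneg {x : EuclideanSpace ℝ (Fin d)} (hf : ConvexOn ℝ U f) (hU : IsOpen U)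
    (hx : x ∈ U) (hd : DifferentiableOn ℝ f U) (hd2 : DifferentiableAt ℝ (gradient f) x)
    (v : EuclideanSpace ℝ (Fin d)) : 0 ≤ inner ℝ (hessian f x v) v := by
  have hline := hasDerivAt_line x v
  have hmem : ∀ᶠ s : ℝ in 𝓝 0, x + s • v ∈ U :=
    hline.continuousAt.eventually_mem (hU.mem_nhds (by simpa using hx))
  have hd2' := hd2.hasFDerivAt
  rw [show x = x + (0 : ℝ) • v by simp] at hd2'
  have hgrad : HasDerivAt (fun s : ℝ => -gradient f (x + s • v)) (-hessian f x v) 0 := by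
    simpa [hessian, Function.comp_def] using (hd2'.comp_hasDerivAt (0 : ℝ) hline).fun_neg
  have h := quadratic_limit_nonpos (Δ := 0) (v := 0) hline hgrad <| by
    filter_upwards [hmem.filter_mono nhdsWithin_le_nhds] with s hs
    have h1 := inner_gradient_sub_nonneg hf hs hx (hd.hasGradientAt (hU.mem_nhds hs))
      (hd.hasGradientAt (hU.mem_nhds hx))
    simp only [smul_zero, inner_zero_left, zero_smul, add_zero, zero_mul, zero_add]
    rw [neg_sub_neg, ← neg_sub, inner_neg_left]
    linarith
  simpa using h

end Convex

/-! ### The minimizer of the perturbed objective -/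

section Minimizer

open Filter Topology

variable {d n : ℕ} {𝒵 : Type*} {Θ U : Set (EuclideanSpace ℝ (Fin d))}
  {ℓ : EuclideanSpace ℝ (Fin d) → 𝒵 → ℝ} {Δ : ℝ}

/-- The standing assumptions for minimizing convex losses `ℓ` over `Θ`: all of them are convex and
differentiable on a common open neighbourhood `U` of the nonempty closed convex set `Θ`. -/
structure ConvexProblem (Θ U : Set (EuclideanSpace ℝ (Fin d)))
    (ℓ : EuclideanSpace ℝ (Fin d) → 𝒵 → ℝ) : Prop where
  nonempty : Θ.Nonempty
  closed : IsClosed Θ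
  convex : Convex ℝ Θ
  isOpen : IsOpen U
  subset : Θ ⊆ U
  convexOn : ∀ z, ConvexOn ℝ U fun θ => ℓ θ z
  differentiableOn : ∀ z, DifferentiableOn ℝ (fun θ => ℓ θ z) U

/-- The gradient of the perturbed objective. -/
noncomputable def objectiveGradient (ℓ : EuclideanSpace ℝ (Fin d) → 𝒵 → ℝ) (Δ : ℝ)
    (Z : Fin n → 𝒵) (b θ : EuclideanSpace ℝ (Fin d)) : EuclideanSpace ℝ (Fin d) :=
  (∑ i, gradient (fun θ' => ℓ θ' (Z i)) θ) + Δ • θ + b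

namespace ConvexProblem

variable (P : ConvexProblem Θ U ℓ)
include P

lemma hasGradientAt {θ : EuclideanSpace ℝ (Fin d)} (hθ : θ ∈ Θ) (z : 𝒵) :
    HasGradientAt (fun θ' => ℓ θ' z) (gradient (fun θ' => ℓ θ' z) θ) θ :=
  (P.differentiableOn z).hasGradientAt (P.isOpen.mem_nhds (P.subset hθ))

lemma hasGradientAt_objective {θ : EuclideanSpace ℝ (Fin d)} (hθ : θ ∈ Θ) (Z : Fin n → 𝒵)
    (b : EuclideanSpace ℝ (Fin d)) :
    HasGradientAt (objective ℓ Δ Z b) (objectiveGradient ℓ Δ Z b θ) θ := by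
  rw [hasGradientAt_iff_hasFDerivAt]
  have h1 : HasFDerivAt (fun θ' => ∑ i, ℓ θ' (Z i))
      (∑ i, innerSL ℝ (gradient (fun θ' => ℓ θ' (Z i)) θ)) θ :=
    HasFDerivAt.fun_sum fun i _ => (P.hasGradientAt hθ (Z i)).hasFDerivAt
  have h2 : HasFDerivAt (fun θ' : EuclideanSpace ℝ (Fin d) => Δ / 2 * ‖θ'‖ ^ 2)
      ((Δ / 2) • (2 • innerSL ℝ θ)) θ :=
    (hasStrictFDerivAt_norm_sq θ).hasFDerivAt.const_mul (Δ / 2)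
  have h3 : HasFDerivAt (fun θ' : EuclideanSpace ℝ (Fin d) => inner ℝ b θ') (innerSL ℝ b) θ :=
    (innerSL ℝ b).hasFDerivAt
  refine ((h1.add h2).add h3).congr_fderiv ?_
  ext v
  simp [objectiveGradient]
  ring

lemma convexOn_objective (hΔ : 0 ≤ Δ) (Z : Fin n → 𝒵) (b : EuclideanSpace ℝ (Fin d)) :
    ConvexOn ℝ Θ (objective ℓ Δ Z b) := by
  have h1 : ConvexOn ℝ Θ fun θ => ∑ i, ℓ θ (Z i) := by
    induction (Finset.univ : Finset (Fin n)) using Finset.induction_on with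
    | empty => simpa using convexOn_const (0 : ℝ) P.convex
    | insert i s hi ih =>
      simp only [Finset.sum_insert hi]
      exact ((P.convexOn (Z i)).subset P.subset P.convex).add ih
  have h2 : ConvexOn ℝ Θ fun θ : EuclideanSpace ℝ (Fin d) => Δ / 2 * ‖θ‖ ^ 2 := by
    have := ((convexOn_univ_norm.pow (fun x _ => norm_nonneg x) 2).smul
      (by positivity : 0 ≤ Δ / 2)).subset (Set.subset_univ Θ) P.convex
    exact this
  exact (h1.add h2).add ((innerₛₗ ℝ b).convexOn P.convex)

/-- A point of `Θ` is a minimizer exactly when it satisfies the variational inequality. -/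
lemma isMinimizer_iff (hΔ : 0 ≤ Δ) {Z : Fin n → 𝒵} {b θ : EuclideanSpace ℝ (Fin d)} :
    IsMinimizer Θ ℓ Δ Z b θ ↔
      θ ∈ Θ ∧ ∀ θ' ∈ Θ, 0 ≤ inner ℝ (objectiveGradient ℓ Δ Z b θ) (θ' - θ) := by
  refine and_congr_right fun hθ => ⟨fun hmin θ' hθ' => ?_, fun h θ' hθ' => ?_⟩
  · have hd := hasDerivAt_comp_segment (v := θ' - θ) (P.hasGradientAt_objective (Δ := Δ) hθ Z b)
    have hd' := (hasDerivAt_iff_tendsto_slope.1 hd).mono_left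
      (nhdsWithin_mono _ (show Set.Ioi (0 : ℝ) ⊆ {0}ᶜ from fun s hs => ne_of_gt hs))
    refine ge_of_tendsto hd' ?_
    filter_upwards [Ioo_mem_nhdsGT zero_lt_one] with s hs
    have hmem : θ + s • (θ' - θ) ∈ Θ :=
      P.convex.add_smul_sub_mem hθ hθ' ⟨hs.1.le, hs.2.le⟩
    have hle : objective ℓ Δ Z b θ ≤ objective ℓ Δ Z b (θ + s • (θ' - θ)) := hmin hmem
    rw [slope_def_field]
    simp only [zero_smul, add_zero, sub_zero]
    exact div_nonneg (sub_nonneg.2 hle) hs.1.le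
  · have := add_inner_gradient_le (P.convexOn_objective hΔ Z b) hθ hθ'
      (P.hasGradientAt_objective hθ Z b)
    have := h θ' hθ'
    change objective ℓ Δ Z b θ ≤ objective ℓ Δ Z b θ'
    linarith

lemma inner_gradient_sub_nonneg {θ θ' : EuclideanSpace ℝ (Fin d)} (hθ : θ ∈ Θ) (hθ' : θ' ∈ Θ)
    (z : 𝒵) :
    0 ≤ inner ℝ (gradient (fun θ => ℓ θ z) θ - gradient (fun θ => ℓ θ z) θ') (θ - θ') :=
  ObjPert.inner_gradient_sub_nonneg (P.convexOn z) (P.subset hθ) (P.subset hθ')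
    (P.hasGradientAt hθ z) (P.hasGradientAt hθ' z)

/-- Strong monotonicity of the solution map, in terms of all the losses. -/
lemma strong_monotone_sum (hΔ : 0 ≤ Δ) {Z : Fin n → 𝒵} {b b' θ θ' : EuclideanSpace ℝ (Fin d)}
    (h : IsMinimizer Θ ℓ Δ Z b θ) (h' : IsMinimizer Θ ℓ Δ Z b' θ') :
    Δ * ‖θ - θ'‖ ^ 2 + ∑ i, inner ℝ (gradient (fun θ => ℓ θ (Z i)) θ
      - gradient (fun θ => ℓ θ (Z i)) θ') (θ - θ') + inner ℝ (b - b') (θ - θ') ≤ 0 := by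
  rw [P.isMinimizer_iff hΔ] at h h'
  have h1 := h.2 θ' h'.1
  have h2 := h'.2 θ h.1
  rw [← neg_sub θ θ', inner_neg_right] at h1
  have h3 : inner ℝ (objectiveGradient ℓ Δ Z b θ - objectiveGradient ℓ Δ Z b' θ') (θ - θ') ≤ 0 := by
    rw [inner_sub_left]; linarith
  have h4 : objectiveGradient ℓ Δ Z b θ - objectiveGradient ℓ Δ Z b' θ' =
      Δ • (θ - θ') + ∑ i, (gradient (fun θ => ℓ θ (Z i)) θ - gradient (fun θ => ℓ θ (Z i)) θ')
        + (b - b') := by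
    simp only [objectiveGradient, Finset.sum_sub_distrib, smul_sub]
    abel
  rwa [h4, inner_add_left, inner_add_left, real_inner_smul_left, real_inner_self_eq_norm_sq,
    sum_inner] at h3

/-- Strong monotonicity of the solution map, keeping only one of the losses. -/
lemma strong_monotone (hΔ : 0 ≤ Δ) {Z : Fin n → 𝒵} (t : Fin n)
    {b b' θ θ' : EuclideanSpace ℝ (Fin d)}
    (h : IsMinimizer Θ ℓ Δ Z b θ) (h' : IsMinimizer Θ ℓ Δ Z b' θ') :
    Δ * ‖θ - θ'‖ ^ 2 + inner ℝ (gradient (fun θ => ℓ θ (Z t)) θ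
      - gradient (fun θ => ℓ θ (Z t)) θ') (θ - θ') + inner ℝ (b - b') (θ - θ') ≤ 0 := by
  have h1 := Finset.single_le_sum (fun i _ => P.inner_gradient_sub_nonneg h.1 h'.1 (Z i))
    (Finset.mem_univ t)
  linarith [P.strong_monotone_sum hΔ h h']

/-- The solution map is `Δ⁻¹`-Lipschitz in the noise. -/
lemma norm_sub_le (hΔ : 0 < Δ) {Z : Fin n → 𝒵} {b b' θ θ' : EuclideanSpace ℝ (Fin d)}
    (h : IsMinimizer Θ ℓ Δ Z b θ) (h' : IsMinimizer Θ ℓ Δ Z b' θ') :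
    ‖θ - θ'‖ ≤ Δ⁻¹ * ‖b - b'‖ := by
  have h1 := P.strong_monotone_sum hΔ.le h h'
  have h2 := Finset.sum_nonneg fun i (_ : i ∈ Finset.univ) =>
    P.inner_gradient_sub_nonneg h.1 h'.1 (Z i)
  have h3 := neg_le_of_abs_le (abs_real_inner_le_norm (b - b') (θ - θ'))
  rw [← div_eq_inv_mul, le_div_iff₀ hΔ]
  by_contra! hlt
  have h4 : 0 < ‖θ - θ'‖ := by
    by_contra! h0
    nlinarith [norm_nonneg (b - b')]
  nlinarith

lemma exists_isMinimizer (hΔ : 0 < Δ) (Z : Fin n → 𝒵) (b : EuclideanSpace ℝ (Fin d)) :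
    ∃ θ, IsMinimizer Θ ℓ Δ Z b θ := by
  obtain ⟨θ₀, hθ₀⟩ := P.nonempty
  have hcont : ContinuousOn (objective ℓ Δ Z b) Θ := fun θ hθ =>
    (P.hasGradientAt_objective hθ Z b).differentiableAt.continuousAt.continuousWithinAt
  refine hcont.exists_isMinOn' P.closed hθ₀ ?_
  -- the objective minus its quadratic part is bounded below by an affine function
  set g := objectiveGradient ℓ 0 Z b θ₀
  set A := objective ℓ 0 Z b θ₀ - inner ℝ g θ₀
  have hlow : ∀ θ ∈ Θ, A - ‖g‖ * ‖θ‖ + Δ / 2 * ‖θ‖ ^ 2 ≤ objective ℓ Δ Z b θ := by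
    intro θ hθ
    have h1 := add_inner_gradient_le (P.convexOn_objective le_rfl Z b) hθ₀ hθ
      (P.hasGradientAt_objective hθ₀ Z b)
    have h2 := neg_le_of_abs_le (abs_real_inner_le_norm g θ)
    have h3 : objective ℓ Δ Z b θ = objective ℓ 0 Z b θ + Δ / 2 * ‖θ‖ ^ 2 := by
      simp [objective]; ring
    rw [inner_sub_right] at h1
    linarith
  have htend : Tendsto (fun r : ℝ => A + r * (Δ / 2 * r - ‖g‖)) atTop atTop :=
    tendsto_atTop_add_const_left _ _ (tendsto_id.atTop_mul_atTop₀
      (tendsto_atTop_add_const_right _ _ (tendsto_id.const_mul_atTop (by positivity))))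
  have hev := ((htend.comp (tendsto_norm_cocompact_atTop
    (E := EuclideanSpace ℝ (Fin d)))).eventually_ge_atTop (objective ℓ Δ Z b θ₀))
  filter_upwards [hev.filter_mono inf_le_left,
    (eventually_principal.2 fun θ (h : θ ∈ Θ) => h).filter_mono inf_le_right] with θ h1 h2
  have := hlow θ h2
  simp only [Function.comp_apply] at h1
  linarith

lemma existsUnique_isMinimizer (hΔ : 0 < Δ) (Z : Fin n → 𝒵) (b : EuclideanSpace ℝ (Fin d)) :
    ∃! θ, IsMinimizer Θ ℓ Δ Z b θ := by
  obtain ⟨θ, hθ⟩ := P.exists_isMinimizer hΔ Z b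
  refine ⟨θ, hθ, fun θ' hθ' => ?_⟩
  have := P.norm_sub_le hΔ hθ' hθ
  simpa [sub_eq_zero] using this

lemma isMinimizer_estimator (hΔ : 0 < Δ) (Z : Fin n → 𝒵) (b : EuclideanSpace ℝ (Fin d)) :
    IsMinimizer Θ ℓ Δ Z b (estimator Θ ℓ Δ Z b) :=
  Classical.epsilon_spec (P.exists_isMinimizer hΔ Z b)

lemma estimator_eq (hΔ : 0 < Δ) {Z : Fin n → 𝒵} {b θ : EuclideanSpace ℝ (Fin d)}
    (h : IsMinimizer Θ ℓ Δ Z b θ) : estimator Θ ℓ Δ Z b = θ :=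
  (P.existsUnique_isMinimizer hΔ Z b).unique (P.isMinimizer_estimator hΔ Z b) h

lemma estimator_mem (hΔ : 0 < Δ) (Z : Fin n → 𝒵) (b : EuclideanSpace ℝ (Fin d)) :
    estimator Θ ℓ Δ Z b ∈ Θ :=
  (P.isMinimizer_estimator hΔ Z b).1

lemma lipschitzWith_estimator (hΔ : 0 < Δ) (Z : Fin n → 𝒵) :
    LipschitzWith (Real.toNNReal Δ⁻¹) (estimator Θ ℓ Δ Z) := by
  refine LipschitzWith.of_dist_le_mul fun b b' => ?_
  rw [Real.coe_toNNReal _ (inv_nonneg.2 hΔ.le), dist_eq_norm, dist_eq_norm]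
  exact P.norm_sub_le hΔ (P.isMinimizer_estimator hΔ Z b) (P.isMinimizer_estimator hΔ Z b')

/-- The infinitesimal form of strong monotonicity: minus the derivative of the solution map is
bounded as if it were the inverse of an operator above `Δ + ∇²ℓ(·; z_t)`. -/
lemma fderiv_estimator_bound (hΔ : 0 < Δ) (Z : Fin n → 𝒵) (t : Fin n)
    {b : EuclideanSpace ℝ (Fin d)} (hb : DifferentiableAt ℝ (estimator Θ ℓ Δ Z) b)
    (h2 : DifferentiableAt ℝ (gradient fun θ => ℓ θ (Z t)) (estimator Θ ℓ Δ Z b))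
    (v : EuclideanSpace ℝ (Fin d)) :
    Δ * ‖fderiv ℝ (estimator Θ ℓ Δ Z) b v‖ ^ 2
      + inner ℝ (hessian (fun θ => ℓ θ (Z t)) (estimator Θ ℓ Δ Z b)
          (fderiv ℝ (estimator Θ ℓ Δ Z) b v)) (fderiv ℝ (estimator Θ ℓ Δ Z) b v)
      + inner ℝ v (fderiv ℝ (estimator Θ ℓ Δ Z) b v) ≤ 0 := by
  have hb0 : b + (0 : ℝ) • v = b := by simp
  have hb' := hb.hasFDerivAt
  have h2' := h2.hasFDerivAt
  rw [← hb0] at hb' h2'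
  have hp := hb'.comp_hasDerivAt (0 : ℝ) (hasDerivAt_line b v)
  have hg := h2'.comp_hasDerivAt (0 : ℝ) hp
  rw [hb0] at hp hg
  refine quadratic_limit_nonpos hp hg (Filter.Eventually.of_forall fun s => ?_)
  have := P.strong_monotone hΔ.le t (P.isMinimizer_estimator hΔ Z (b + s • v))
    (P.isMinimizer_estimator hΔ Z b)
  simpa using this

end ConvexProblem

end Minimizer

/-! ### Shifting the noise -/

section Shift

variable {d n : ℕ} {𝒵 : Type*} {Θ U : Set (EuclideanSpace ℝ (Fin d))}
  {ℓ : EuclideanSpace ℝ (Fin d) → 𝒵 → ℝ} {Δ : ℝ}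

/-- Change of variables for the noise: an injective differentiable map which loses at most a factor
`exp κ` in the density and at most a factor `exp τ` in the volume loses at most a factor
`exp (κ + τ)` in probability. -/
lemma noise_le_exp_mul_noise_image {σ κ τ : ℝ} (hσ : 0 < σ)
    {T : EuclideanSpace ℝ (Fin d) → EuclideanSpace ℝ (Fin d)}
    {T' : EuclideanSpace ℝ (Fin d) → EuclideanSpace ℝ (Fin d) →L[ℝ] EuclideanSpace ℝ (Fin d)}
    {A : Set (EuclideanSpace ℝ (Fin d))} (hA : MeasurableSet A)
    (hT : ∀ x ∈ A, HasFDerivAt T (T' x) x) (hinj : A.InjOn T)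
    (hdens : ∀ x ∈ A, noiseDensity d σ x ≤ Real.exp κ * noiseDensity d σ (T x))
    (hdet : ∀ x ∈ A, Real.exp (-τ) ≤ (T' x).det) :
    noise d σ A ≤ ENNReal.ofReal (Real.exp (κ + τ)) * noise d σ (T '' A) := by
  rw [noise_eq_withDensity hσ, withDensity_apply' _ A, withDensity_apply' _ (T '' A),
    lintegral_image_eq_lintegral_abs_det_fderiv_mul _ hA
      (fun x hx => (hT x hx).hasFDerivWithinAt) hinj,
    ← lintegral_const_mul' _ _ ENNReal.ofReal_ne_top]
  refine setLIntegral_mono' hA fun x hx => ?_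
  rw [← ENNReal.ofReal_mul (abs_nonneg _), ← ENNReal.ofReal_mul (Real.exp_pos _).le]
  refine ENNReal.ofReal_le_ofReal ((hdens x hx).trans ?_)
  have h1 : 1 ≤ Real.exp τ * |(T' x).det| := by
    calc (1 : ℝ) = Real.exp τ * Real.exp (-τ) := by rw [← Real.exp_add]; simp
      _ ≤ _ := by gcongr; exact (hdet x hx).trans (le_abs_self _)
  calc Real.exp κ * noiseDensity d σ (T x)
      = Real.exp κ * noiseDensity d σ (T x) * 1 := (mul_one _).symm
    _ ≤ Real.exp κ * noiseDensity d σ (T x) * (Real.exp τ * |(T' x).det|) := by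
        gcongr
        exact mul_nonneg (Real.exp_pos _).le (noiseDensity_nonneg _ _)
    _ = Real.exp (κ + τ) * (|(T' x).det| * noiseDensity d σ (T x)) := by
        rw [Real.exp_add]; ring

/-- The noise for which the record `z'` in place of `z` gives the same minimizer as the noise `b`
with `z`; here `θ b` is that minimizer. -/
noncomputable def shift (ℓ : EuclideanSpace ℝ (Fin d) → 𝒵 → ℝ) (z z' : 𝒵)
    (θ : EuclideanSpace ℝ (Fin d) → EuclideanSpace ℝ (Fin d)) (b : EuclideanSpace ℝ (Fin d)) :
    EuclideanSpace ℝ (Fin d) :=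
  b + (gradient (fun θ' => ℓ θ' z) (θ b) - gradient (fun θ' => ℓ θ' z') (θ b))

lemma objectiveGradient_shift {t : Fin n} {Z Z' : Fin n → 𝒵} (h : Neighboring t Z Z')
    (θ : EuclideanSpace ℝ (Fin d) → EuclideanSpace ℝ (Fin d)) (b : EuclideanSpace ℝ (Fin d)) :
    objectiveGradient ℓ Δ Z' (shift ℓ (Z t) (Z' t) θ b) (θ b) = objectiveGradient ℓ Δ Z b (θ b) := by
  have h1 : ∑ i ∈ Finset.univ.erase t, gradient (fun θ' => ℓ θ' (Z' i)) (θ b) =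
      ∑ i ∈ Finset.univ.erase t, gradient (fun θ' => ℓ θ' (Z i)) (θ b) :=
    Finset.sum_congr rfl fun i hi => by rw [h i (Finset.ne_of_mem_erase hi)]
  rw [objectiveGradient, objectiveGradient, shift,
    ← Finset.add_sum_erase _ (fun i => gradient (fun θ' => ℓ θ' (Z' i)) (θ b)) (Finset.mem_univ t),
    ← Finset.add_sum_erase _ (fun i => gradient (fun θ' => ℓ θ' (Z i)) (θ b)) (Finset.mem_univ t),
    h1]
  abel

namespace ConvexProblem

variable (P : ConvexProblem Θ U ℓ)
include P

/-- The shifted noise has the same minimizer for the neighbouring dataset. -/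
lemma estimator_shift (hΔ : 0 < Δ) {t : Fin n} {Z Z' : Fin n → 𝒵} (h : Neighboring t Z Z')
    (b : EuclideanSpace ℝ (Fin d)) :
    estimator Θ ℓ Δ Z' (shift ℓ (Z t) (Z' t) (estimator Θ ℓ Δ Z) b) = estimator Θ ℓ Δ Z b := by
  refine P.estimator_eq hΔ ((P.isMinimizer_iff hΔ.le).2 ?_)
  rw [objectiveGradient_shift h]
  exact (P.isMinimizer_iff hΔ.le).1 (P.isMinimizer_estimator hΔ Z b)

lemma injective_shift (hΔ : 0 < Δ) {t : Fin n} {Z Z' : Fin n → 𝒵} (h : Neighboring t Z Z') :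
    Function.Injective (shift ℓ (Z t) (Z' t) (estimator Θ ℓ Δ Z)) := by
  intro b b' hbb
  have hθ : estimator Θ ℓ Δ Z b = estimator Θ ℓ Δ Z b' := by
    rw [← P.estimator_shift hΔ h b, ← P.estimator_shift hΔ h b', hbb]
  simpa [shift, hθ] using hbb

/-- If all gradients vanish on `Θ`, the minimizer does not depend on the dataset. -/
lemma estimator_eq_estimator_of_gradient_eq_zero (hΔ : 0 < Δ)
    (h0 : ∀ θ ∈ Θ, ∀ z, gradient (fun θ' => ℓ θ' z) θ = 0) (Z Z' : Fin n → 𝒵) :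
    estimator Θ ℓ Δ Z = estimator Θ ℓ Δ Z' := by
  funext b
  refine P.estimator_eq hΔ ((P.isMinimizer_iff hΔ.le).2 ?_)
  have h := (P.isMinimizer_iff hΔ.le).1 (P.isMinimizer_estimator hΔ Z' b)
  have : objectiveGradient ℓ Δ Z b (estimator Θ ℓ Δ Z' b) =
      objectiveGradient ℓ Δ Z' b (estimator Θ ℓ Δ Z' b) := by
    simp [objectiveGradient, h0 _ h.1]
  rwa [this]

/-- At a point of differentiability of the estimator the shift of the noise loses at most a factor
`exp (c / Δ)` in volume, where `c` bounds the trace of the Hessian of the removed loss. -/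
lemma hasFDerivAt_shift {R : ℕ} {η c : ℝ} (hΔ : 0 < Δ)
    (h_diff2 : ∀ z, DifferentiableOn ℝ (gradient (fun θ => ℓ θ z)) U)
    (h_eig : ∀ θ ∈ Θ, ∀ z, ∀ μ : ℝ,
      Module.End.HasEigenvalue (hessian (fun θ' => ℓ θ' z) θ).toLinearMap μ → μ ≤ η)
    (h_rank : ∀ θ ∈ Θ, ∀ z,
      Module.finrank ℝ (hessian (fun θ' => ℓ θ' z) θ).toLinearMap.range ≤ R)
    (hc : 0 ≤ c) (hRc : R * η ≤ c) (Z : Fin n → 𝒵) (t : Fin n) (z' : 𝒵)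
    {b : EuclideanSpace ℝ (Fin d)} (hb : DifferentiableAt ℝ (estimator Θ ℓ Δ Z) b) :
    ∃ T', HasFDerivAt (shift ℓ (Z t) z' (estimator Θ ℓ Δ Z)) T' b ∧
      Real.exp (-(c / Δ)) ≤ T'.det := by
  set θ := estimator Θ ℓ Δ Z b
  have hθ : θ ∈ Θ := P.estimator_mem hΔ Z b
  have hUθ : U ∈ nhds θ := P.isOpen.mem_nhds (P.subset hθ)
  have hg : ∀ z, DifferentiableAt ℝ (gradient fun θ' => ℓ θ' z) θ := fun z =>
    (h_diff2 z).differentiableAt hUθ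
  set D := fderiv ℝ (estimator Θ ℓ Δ Z) b
  set H : 𝒵 → EuclideanSpace ℝ (Fin d) →L[ℝ] EuclideanSpace ℝ (Fin d) :=
    fun z => hessian (fun θ' => ℓ θ' z) θ
  refine ⟨ContinuousLinearMap.id ℝ _ + ((H (Z t)).comp D - (H z').comp D),
    (hasFDerivAt_id b).add (((hg (Z t)).hasFDerivAt.comp b hb.hasFDerivAt).sub
      ((hg z').hasFDerivAt.comp b hb.hasFDerivAt)), ?_⟩
  have hsymm : ∀ z, (H z).toLinearMap.IsSymmetric := fun z =>
    hessian_isSymmetric hUθ (P.differentiableOn z) (hg z)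
  have hpos : ∀ z x, 0 ≤ inner ℝ ((H z).toLinearMap x) x := fun z x =>
    inner_hessian_nonneg (P.convexOn z) P.isOpen (P.subset hθ) (P.differentiableOn z) (hg z) x
  have key := exp_neg_le_det (K := (-D).toLinearMap) hΔ (hsymm (Z t)) (hsymm z') (hpos _) (hpos _)
    (h_eig θ hθ (Z t)) (h_rank θ hθ (Z t)) hc hRc fun v => by
      have := P.fderiv_estimator_bound hΔ Z t hb (hg (Z t)) v
      simp only [ContinuousLinearMap.coe_coe, neg_apply, norm_neg, map_neg,
        inner_neg_left, inner_neg_right, neg_neg]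
      linarith
  rw [ContinuousLinearMap.det]
  convert key using 2
  ext1 x
  simp [sub_eq_add_neg]
  abel

/-- The privacy inequality, for an event with the large noise vectors removed. -/
lemma noise_preimage_le {R : ℕ} {L η c κ σ r : ℝ} (hΔ : 0 < Δ) (hσ : 0 < σ)
    (h_diff2 : ∀ z, DifferentiableOn ℝ (gradient (fun θ => ℓ θ z)) U)
    (h_grad : ∀ θ ∈ Θ, ∀ z, ‖gradient (fun θ' => ℓ θ' z) θ‖ ≤ L)
    (h_eig : ∀ θ ∈ Θ, ∀ z, ∀ μ : ℝ,
      Module.End.HasEigenvalue (hessian (fun θ' => ℓ θ' z) θ).toLinearMap μ → μ ≤ η)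
    (h_rank : ∀ θ ∈ Θ, ∀ z,
      Module.finrank ℝ (hessian (fun θ' => ℓ θ' z) θ).toLinearMap.range ≤ R)
    (hc : 0 ≤ c) (hRc : R * η ≤ c)
    (hr : 2 * r * (2 * L) + (2 * L) ^ 2 ≤ 2 * σ ^ 2 * κ)
    {t : Fin n} {Z Z' : Fin n → 𝒵} (h : Neighboring t Z Z')
    {S : Set (EuclideanSpace ℝ (Fin d))} (hS : MeasurableSet S) :
    noise d σ (estimator Θ ℓ Δ Z ⁻¹' S) ≤
      ENNReal.ofReal (Real.exp (κ + c / Δ)) * noise d σ (estimator Θ ℓ Δ Z' ⁻¹' S)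
        + noise d σ {b | r < ‖b‖} := by
  classical
  set e := estimator Θ ℓ Δ Z
  set D : Set (EuclideanSpace ℝ (Fin d)) := {b | DifferentiableAt ℝ e b}
  have hD : MeasurableSet D := measurableSet_of_differentiableAt ℝ e
  have hDnull : noise d σ Dᶜ = 0 := by
    rw [noise_eq_withDensity hσ]
    exact withDensity_absolutelyContinuous _ _ (P.lipschitzWith_estimator hΔ Z).ae_differentiableAt
  have hmeas : Measurable e := (P.lipschitzWith_estimator hΔ Z).continuous.measurable
  set A := (e ⁻¹' S ∩ {b | ‖b‖ ≤ r}) ∩ D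
  have hA : MeasurableSet A :=
    ((hmeas hS).inter (measurableSet_le measurable_norm measurable_const)).inter hD
  have hcover : e ⁻¹' S ⊆ (A ∪ {b | r < ‖b‖}) ∪ Dᶜ := by
    intro b hb
    by_cases h1 : r < ‖b‖
    · exact Or.inl (Or.inr h1)
    · by_cases h2 : b ∈ D
      · exact Or.inl (Or.inl ⟨⟨hb, not_lt.1 h1⟩, h2⟩)
      · exact Or.inr h2
  have hderiv := fun b (hb : b ∈ D) =>
    P.hasFDerivAt_shift hΔ h_diff2 h_eig h_rank hc hRc Z t (Z' t) hb
  choose! T' hT' hdet using hderiv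
  have himage : shift ℓ (Z t) (Z' t) e '' A ⊆ estimator Θ ℓ Δ Z' ⁻¹' S := by
    rintro _ ⟨b, hb, rfl⟩
    rw [Set.mem_preimage, P.estimator_shift hΔ h b]
    exact hb.1.1
  have hmain : noise d σ A ≤ ENNReal.ofReal (Real.exp (κ + c / Δ)) *
      noise d σ (shift ℓ (Z t) (Z' t) e '' A) := by
    refine noise_le_exp_mul_noise_image hσ hA (fun x hx => hT' x hx.2)
      (P.injective_shift hΔ h).injOn (fun x hx => ?_) fun x hx => hdet x hx.2
    refine noiseDensity_le hσ hx.1.2 ?_ hr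
    have hx' : e x ∈ Θ := P.estimator_mem hΔ Z x
    refine (_root_.norm_sub_le _ _).trans ?_
    linarith [h_grad (e x) hx' (Z t), h_grad (e x) hx' (Z' t)]
  calc noise d σ (e ⁻¹' S) ≤ noise d σ ((A ∪ {b | r < ‖b‖}) ∪ Dᶜ) := measure_mono hcover
    _ ≤ noise d σ A + noise d σ {b | r < ‖b‖} + noise d σ Dᶜ :=
        (measure_union_le _ _).trans (by gcongr; exact measure_union_le _ _)
    _ = noise d σ A + noise d σ {b | r < ‖b‖} := by rw [hDnull, add_zero]
    _ ≤ _ := by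
        gcongr
        exact hmain.trans (by gcongr)

end ConvexProblem

/-- The lower bound for `σ` is the positive root of `κ σ² = 2 L C σ + 2 L²`. -/
lemma noise_scale_bound {L κ σ a : ℝ} (hL : 0 ≤ L) (hκ : 0 < κ) (ha : 0 ≤ a)
    (hσ : L * (√a + √(a + 2 * κ)) / κ ≤ σ) :
    2 * (σ * √a) * (2 * L) + (2 * L) ^ 2 ≤ 2 * σ ^ 2 * κ := by
  rw [div_le_iff₀ hκ] at hσ
  have h1 : √a ^ 2 = a := Real.sq_sqrt ha
  have h2 : √(a + 2 * κ) ^ 2 = a + 2 * κ := Real.sq_sqrt (by positivity)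
  have h3 : (L * √(a + 2 * κ)) ^ 2 ≤ (σ * κ - L * √a) ^ 2 :=
    pow_le_pow_left₀ (by positivity) (by linarith) 2
  rw [mul_pow, h2] at h3
  have h4 : κ * (2 * (σ * √a) * (2 * L) + (2 * L) ^ 2) ≤ κ * (2 * σ ^ 2 * κ) := by
    have h5 : (L * √a) ^ 2 = L ^ 2 * a := by rw [mul_pow, h1]
    nlinarith
  exact le_of_mul_le_mul_left h4 hκ

end Shift

end ObjPert

/-! ### The privacy guarantee -/

theorem mainTheorem6 {d n R : ℕ} {𝒵 : Type*}
    (Θ U : Set (EuclideanSpace ℝ (Fin d)))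
    (hΘ_nonempty : Θ.Nonempty) (hΘ_closed : IsClosed Θ) (hΘ_convex : Convex ℝ Θ)
    (hU : IsOpen U) (hΘU : Θ ⊆ U)
    (ℓ : EuclideanSpace ℝ (Fin d) → 𝒵 → ℝ) (L η Δ σ ε δ q : ℝ)
    (h_convex : ∀ z, ConvexOn ℝ U (fun θ => ℓ θ z))
    (h_diff : ∀ z, DifferentiableOn ℝ (fun θ => ℓ θ z) U)
    (h_diff2 : ∀ z, DifferentiableOn ℝ (gradient (fun θ => ℓ θ z)) U)
    (h_grad : ∀ θ ∈ Θ, ∀ z, ‖gradient (fun θ' => ℓ θ' z) θ‖ ≤ L)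
    (h_eig : ∀ θ ∈ Θ, ∀ z, ∀ μ : ℝ,
      Module.End.HasEigenvalue (ObjPert.hessian (fun θ' => ℓ θ' z) θ).toLinearMap μ → μ ≤ η)
    (h_rank : ∀ θ ∈ Θ, ∀ z,
      Module.finrank ℝ (ObjPert.hessian (fun θ' => ℓ θ' z) θ).toLinearMap.range ≤ R)
    (hε : 0 < ε) (hδ : 0 < δ) (hq0 : 0 < q) (hq1 : q < 1)
    (hΔ_pos : 0 < Δ) (hΔ : R * η / ((1 - q) * ε) ≤ Δ)
    (hσ : L * (√(d + 2 * √(d * Real.log (2 / δ)) + 2 * Real.log (2 / δ))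
        + √(d + 2 * √(d * Real.log (2 / δ)) + 2 * Real.log (2 / δ) + 2 * q * ε)) / (q * ε) ≤ σ) :
    (∀ (Z : Fin n → 𝒵) (b : EuclideanSpace ℝ (Fin d)),
      ∃! θ, ObjPert.IsMinimizer Θ ℓ Δ Z b θ) ∧
    (∀ Z : Fin n → 𝒵, Measurable (ObjPert.estimator Θ ℓ Δ Z)) ∧
    ObjPert.IsBoundedDP (ObjPert.mechanism n Θ ℓ Δ σ) ε δ := by

  have P : ObjPert.ConvexProblem Θ U ℓ :=
    ⟨hΘ_nonempty, hΘ_closed, hΘ_convex, hU, hΘU, h_convex, h_diff⟩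
  have hmeas : ∀ Z : Fin n → 𝒵, Measurable (ObjPert.estimator Θ ℓ Δ Z) := fun Z =>
    (P.lipschitzWith_estimator hΔ_pos Z).continuous.measurable
  refine ⟨P.existsUnique_isMinimizer hΔ_pos, hmeas, fun t Z Z' hZ S hS => ?_⟩
  rw [ObjPert.mechanism, ObjPert.mechanism, Measure.map_apply (hmeas Z) hS,
    Measure.map_apply (hmeas Z') hS]
  rcases le_or_gt 1 δ with hδ1 | hδ1
  · calc ObjPert.noise d σ (ObjPert.estimator Θ ℓ Δ Z ⁻¹' S) ≤ 1 := prob_le_one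
      _ ≤ ENNReal.ofReal δ := ENNReal.one_le_ofReal.2 hδ1
      _ ≤ _ := le_add_self
  obtain ⟨θ₀, hθ₀⟩ := hΘ_nonempty
  have hL : 0 ≤ L := (norm_nonneg _).trans (h_grad θ₀ hθ₀ (Z t))
  -- for `L = 0` the noise may be degenerate, but then the estimator ignores the dataset
  rcases hL.eq_or_lt with hL0 | hLpos
  · rw [P.estimator_eq_estimator_of_gradient_eq_zero hΔ_pos
      (fun θ hθ z => norm_le_zero_iff.1 (hL0 ▸ h_grad θ hθ z)) Z Z']
    refine le_add_right (le_mul_of_one_le_left zero_le ?_)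
    exact ENNReal.one_le_ofReal.2 (Real.one_le_exp hε.le)
  have hlog : 0 < Real.log (2 / δ) := Real.log_pos (by rw [lt_div_iff₀ hδ]; linarith)
  have hκ : 0 < q * ε := mul_pos hq0 hε
  set a : ℝ := d + 2 * √(d * Real.log (2 / δ)) + 2 * Real.log (2 / δ)
  have ha : 0 < a := by positivity
  rw [mul_assoc 2 q ε] at hσ
  have hσ0 : 0 < σ := lt_of_lt_of_le (by positivity) hσ
  have hRc : R * η ≤ Δ * ((1 - q) * ε) :=
    (div_le_iff₀ (mul_pos (sub_pos.2 hq1) hε)).1 hΔ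
  have h := P.noise_preimage_le hΔ_pos hσ0 h_diff2 h_grad h_eig h_rank
    (mul_nonneg hΔ_pos.le (mul_nonneg (sub_nonneg.2 hq1.le) hε.le)) hRc
    (ObjPert.noise_scale_bound hL hκ ha.le hσ) hZ hS
  have hexp : q * ε + Δ * ((1 - q) * ε) / Δ = ε := by field_simp; ring
  rw [hexp] at h
  refine h.trans (add_le_add_right ((ObjPert.noise_norm_gt_le hσ0 hlog.le).trans ?_) _)
  refine ENNReal.ofReal_le_ofReal ?_
  rw [Real.exp_neg, Real.exp_log (by positivity), inv_div]
  linarith
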